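/- Let $X$ be a finite-dimensional real Euclidean space, and equip the space of linear operators $X\to X$ with the inner product $\langle A,B\rangle=\operatorname{tr}(AB^*)$. Let $\mathcal H$ be a linear subspace of the self-adjoint operators such that (i) $I\in\mathcal H$; (ii) $AFA\in\mathcal H$ for all $A,F\in\mathcal H$; (iii) the orthogonal projection $P_{\mathcal H}$ onto $\mathcal H$ maps positive definite operators to positive definite operators. For $z\in X$ let $z\otimes z$ denote the operator $x\mapsto\langle z,x\rangle z$, and put $$\|x\|_{\mathcal H}=\big\|\sqrt{P_{\mathcal H}(x\otimes x)}\big\|_{\mathrm{op}},\qquad \|x\|_*=\big\|\sqrt{P_{\mathcal H}(x\otimes x)}\big\|_{\mathrm{tr}},\qquad Q_R=\{x\in X:\|x\|_{\mathcal H}\le R\}.$$ Let $R>0$, $\eta=R$, $\delta>0$, and let $g_0,g_1,\dots\in X$ be arbitrary (no bound on the gradients is assumed). Generalized Leon starts with $x_0=0$, $m_{-1}=0$, $S_{-1}=\delta^2I$ and sets, for $k=0,1,\dots$, $$m_k=m_{k-1}+g_k,\qquad S_k=S_{k-1}+P_{\mathcal H}(g_k\otimes g_k),\qquad x_{k+1}=-\nabla\Psi_k^*(m_k),$$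 $$\Psi_k^*(m)=\eta\,\big\|\sqrt{P_{\mathcal H}(m\otimes m)+S_k}\big\|_{\mathrm{tr}},$$ so that $S_K=\delta^2I+\sum_{i=0}^KP_{\mathcal H}(g_i\otimes g_i)$. **Theorem.** There is an absolute constant $C>0$ such that, for all $X$, $\mathcal H$, $R$, $\delta$, $(g_k)$ as above and every $K\ge 0$, the following holds. The algorithm is well defined ($\Psi_0^*,\dots,\Psi_K^*$ are differentiable on $X$), its output is feasible ($x_0,\dots,x_K\in Q_R$), the maximum in $$\mathrm{Reg}_K=\max_{x\in Q_R}\sum_{k=0}^K\langle g_k,x_k-x\rangle$$ is attained, and $$\mathrm{Reg}_K\le C\Big(\delta R\dim X+R\,\|g_0\|_*+R\,\big\|\sqrt{S_K}\big\|_{\mathrm{tr}}\Big).$$ Moreover, for fixed $X,\mathcal H,R,K$, as $\delta\to0^+$ the expression in parentheses converges, uniformly over all gradient sequences $(g_k)$, to $$R\,\|g_0\|_*+R\,\Big\|\sqrt{\textstyle\sum_{i=0}^KP_{\mathcal H}(g_i\otimes g_i)}\Big\|_{\mathrm{tr}},$$ which has no term in the dimension of $X$. -/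

import Mathlib

open Filter Topology
open scoped InnerProductSpace Gradient

noncomputable section

namespace GenLeon

variable {X : Type*} [NormedAddCommGroup X] [InnerProductSpace ℝ X] [FiniteDimensional ℝ X]

/-! ### Operators on a finite-dimensional Euclidean space -/

/-- The inner product `⟨A, B⟩ = tr (A B*)` on the space of linear operators `X → X`. -/
@[reducible]
def opInnerCore : InnerProductSpace.Core ℝ (X →ₗ[ℝ] X) where
  inner A B := LinearMap.trace ℝ X (A * LinearMap.adjoint B)
  conj_inner_symm A B := by
    have h : LinearMap.adjoint (B * LinearMap.adjoint A) = A * LinearMap.adjoint B := by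
      simp [Module.End.mul_eq_comp, LinearMap.adjoint_comp]
    simp only [conj_trivial]
    rw [← h, LinearMap.trace_eq_sum_inner _ (stdOrthonormalBasis ℝ X),
      LinearMap.trace_eq_sum_inner _ (stdOrthonormalBasis ℝ X)]
    refine Finset.sum_congr rfl fun i _ => ?_
    rw [LinearMap.adjoint_inner_right, real_inner_comm]
  re_inner_nonneg A := (LinearMap.isPositive_self_comp_adjoint A).trace_nonneg
  add_left A B C := by simp [add_mul]
  smul_left A B r := by simp
  definite A h := by
    have h' : LinearMap.trace ℝ X (A * LinearMap.adjoint A) = 0 := h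
    rw [LinearMap.trace_eq_sum_inner _ (stdOrthonormalBasis ℝ X)] at h'
    have key : ∀ x : X, ⟪x, (A * LinearMap.adjoint A) x⟫_ℝ = ‖LinearMap.adjoint A x‖ ^ 2 := by
      intro x
      rw [Module.End.mul_apply, ← LinearMap.adjoint_inner_left, real_inner_self_eq_norm_sq]
    simp only [key] at h'
    rw [Finset.sum_eq_zero_iff_of_nonneg (fun _ _ => by positivity)] at h'
    have h0 : LinearMap.adjoint A = 0 :=
      (stdOrthonormalBasis ℝ X).toBasis.ext fun i => by
        simpa using h' i (Finset.mem_univ i)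
    simpa using congrArg LinearMap.adjoint h0

/-- The orthogonal projection onto a linear subspace `H` of operators, with respect to the inner
product `⟨A, B⟩ = tr (A B*)`. -/
def opProj (H : Submodule ℝ (X →ₗ[ℝ] X)) : (X →ₗ[ℝ] X) →ₗ[ℝ] (X →ₗ[ℝ] X) :=
  letI : NormedAddCommGroup (X →ₗ[ℝ] X) := opInnerCore.toNormedAddCommGroup
  letI : InnerProductSpace ℝ (X →ₗ[ℝ] X) := InnerProductSpace.ofCore opInnerCore.toCore
  (H.starProjection : (X →ₗ[ℝ] X) →ₗ[ℝ] (X →ₗ[ℝ] X))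

theorem opProj_mem (H : Submodule ℝ (X →ₗ[ℝ] X)) (A : X →ₗ[ℝ] X) : opProj H A ∈ H :=
  letI : NormedAddCommGroup (X →ₗ[ℝ] X) := opInnerCore.toNormedAddCommGroup
  letI : InnerProductSpace ℝ (X →ₗ[ℝ] X) := InnerProductSpace.ofCore opInnerCore.toCore
  H.starProjection_apply_mem A

theorem trace_sub_opProj (H : Submodule ℝ (X →ₗ[ℝ] X)) (A : X →ₗ[ℝ] X) {B : X →ₗ[ℝ] X}
    (hB : B ∈ H) : LinearMap.trace ℝ X ((A - opProj H A) * LinearMap.adjoint B) = 0 :=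
  letI : NormedAddCommGroup (X →ₗ[ℝ] X) := opInnerCore.toNormedAddCommGroup
  letI : InnerProductSpace ℝ (X →ₗ[ℝ] X) := InnerProductSpace.ofCore opInnerCore.toCore
  H.starProjection_inner_eq_zero A B hB

/-- The symmetric rank-one operator `z ⊗ z : x ↦ ⟨z, x⟩ z`. -/
def outer (z : X) : X →ₗ[ℝ] X :=
  (InnerProductSpace.rankOne ℝ z z : X →L[ℝ] X)

/-- Positive definite self-adjoint operators. -/
def IsPosDef (A : X →ₗ[ℝ] X) : Prop :=
  A.IsSymmetric ∧ ∀ x : X, x ≠ 0 → 0 < ⟪x, A x⟫_ℝ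

open Classical in
/-- The square root of a positive semidefinite operator, through its spectral decomposition
(`0` if the operator is not self-adjoint). -/
def opSqrt (A : X →ₗ[ℝ] X) : X →ₗ[ℝ] X :=
  if h : A.IsSymmetric then
    ∑ i, Real.sqrt (h.eigenvalues rfl i) • outer (h.eigenvectorBasis rfl i)
  else 0

theorem opSqrt_isPositive (A : X →ₗ[ℝ] X) : (opSqrt A).IsPositive := by
  unfold opSqrt
  split_ifs with h
  · refine LinearMap.isPositive_sum _ fun i _ => ?_
    refine LinearMap.IsPositive.smul_of_nonneg ?_ (Real.sqrt_nonneg _)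
    exact (ContinuousLinearMap.isPositive_toLinearMap_iff _).2
      (InnerProductSpace.isPositive_rankOne_self _)
  · exact LinearMap.isPositive_zero

theorem opSqrt_mul_self {A : X →ₗ[ℝ] X} (hA : A.IsPositive) : opSqrt A * opSqrt A = A := by
  have h := hA.isSymmetric
  have hs : ∀ j, opSqrt A (h.eigenvectorBasis rfl j) =
      Real.sqrt (h.eigenvalues rfl j) • h.eigenvectorBasis rfl j := by
    intro j
    simp only [opSqrt, h, dite_true, LinearMap.sum_apply, LinearMap.smul_apply, outer,
      ContinuousLinearMap.coe_coe, InnerProductSpace.rankOne_apply]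
    rw [Finset.sum_eq_single j]
    · simp
    · intro i _ hij
      rw [orthonormal_iff_ite.1 (h.eigenvectorBasis rfl).orthonormal i j]
      simp [hij]
    · simp
  refine (h.eigenvectorBasis rfl).toBasis.ext fun j => ?_
  simp only [OrthonormalBasis.coe_toBasis, Module.End.mul_apply, hs, map_smul, smul_smul]
  rw [Real.mul_self_sqrt (hA.nonneg_eigenvalues rfl j), h.apply_eigenvectorBasis]
  rfl

/-- The operator norm `max_{‖x‖ ≤ 1} ‖A x‖`. -/
def opNorm (A : X →ₗ[ℝ] X) : ℝ := ‖LinearMap.toContinuousLinearMap A‖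

/-- The trace norm `tr √(A A*)`. -/
def traceNorm (A : X →ₗ[ℝ] X) : ℝ :=
  LinearMap.trace ℝ X (opSqrt (A * LinearMap.adjoint A))

/-! ### The preconditioner space and its norms -/

/-- The standing assumption on the linear space `H` of self-adjoint operators. -/
structure IsAdmissible (H : Submodule ℝ (X →ₗ[ℝ] X)) : Prop where
  symmetric : ∀ A ∈ H, A.IsSymmetric
  one_mem : (1 : X →ₗ[ℝ] X) ∈ H
  mul_mul_mem : ∀ A ∈ H, ∀ B ∈ H, A * B * A ∈ H
  proj_posDef : ∀ A : X →ₗ[ℝ] X, IsPosDef A → IsPosDef (opProj H A)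

/-- The primal norm `‖√(P_H (x ⊗ x))‖_op`. -/
def primalNorm (H : Submodule ℝ (X →ₗ[ℝ] X)) (x : X) : ℝ :=
  opNorm (opSqrt (opProj H (outer x)))

/-- The dual norm `‖√(P_H (x ⊗ x))‖_tr`. -/
def dualNorm (H : Submodule ℝ (X →ₗ[ℝ] X)) (x : X) : ℝ :=
  traceNorm (opSqrt (opProj H (outer x)))

/-- The decision set: the ball of radius `R` of the primal norm. -/
def decisionSet (H : Submodule ℝ (X →ₗ[ℝ] X)) (R : ℝ) : Set X :=
  {x | primalNorm H x ≤ R}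

/-! ### The algorithm -/

/-- The dual regularizer `Ψ*(m) = η ‖√(P_H (m ⊗ m) + S)‖_tr`. -/
def dualReg (H : Submodule ℝ (X →ₗ[ℝ] X)) (η : ℝ) (S : X →ₗ[ℝ] X) (m : X) : ℝ :=
  η * traceNorm (opSqrt (opProj H (outer m) + S))

/-- The state of the algorithm: the current iterate, the sum `m` of the gradients observed so far
and the accumulation operator `S`. -/
structure State (X : Type*) [NormedAddCommGroup X] [InnerProductSpace ℝ X] where
  x : X
  m : X
  S : X →ₗ[ℝ] X

/-- The state of generalized Leon after it has observed `g 0, …, g (n - 1)`; it consists of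
`x_n`, `m_{n-1}` and `S_{n-1}`. -/
def leon (H : Submodule ℝ (X →ₗ[ℝ] X)) (η δ : ℝ) (g : ℕ → X) : ℕ → State X
  | 0 => { x := 0, m := 0, S := δ ^ 2 • 1 }
  | n + 1 =>
    let m := (leon H η δ g n).m + g n
    let S := (leon H η δ g n).S + opProj H (outer (g n))
    { x := -∇ (dualReg H η S) m, m := m, S := S }

/-- The operator `S_K = δ² I + ∑_{i ≤ K} P_H (g_i ⊗ g_i)`. -/
def accum (H : Submodule ℝ (X →ₗ[ℝ] X)) (δ : ℝ) (g : ℕ → X) (K : ℕ) : X →ₗ[ℝ] X :=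
  δ ^ 2 • 1 + ∑ i ∈ Finset.range (K + 1), opProj H (outer (g i))

theorem leon_S (H : Submodule ℝ (X →ₗ[ℝ] X)) (η δ : ℝ) (g : ℕ → X) (K : ℕ) :
    (leon H η δ g (K + 1)).S = accum H δ g K := by
  induction K with
  | zero => simp [leon, accum]
  | succ K ih =>
    have h : (leon H η δ g (K + 2)).S =
      (leon H η δ g (K + 1)).S + opProj H (outer (g (K + 1))) := rfl
    rw [h, ih, accum, accum, Finset.sum_range_succ _ (K + 1), add_assoc]

/-- The cumulative linear loss `∑_{k ≤ K} ⟨g_k, x_k - u⟩` relative to a comparator `u`. -/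
def relLoss (g x : ℕ → X) (K : ℕ) (u : X) : ℝ :=
  ∑ k ∈ Finset.range (K + 1), ⟪g k, x k - u⟫_ℝ

/-- The regret `Reg_K = max_{u ∈ Q_R} ∑_{k ≤ K} ⟨g_k, x_k - u⟩`. -/
def regret (H : Submodule ℝ (X →ₗ[ℝ] X)) (R : ℝ) (g x : ℕ → X) (K : ℕ) : ℝ :=
  sSup (relLoss g x K '' decisionSet H R)

/-- The expression `δ R dim X + R ‖g_0‖_* + R ‖√S_K‖_tr`. -/
def boundExpr (H : Submodule ℝ (X →ₗ[ℝ] X)) (R δ : ℝ) (g : ℕ → X) (K : ℕ) : ℝ :=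
  δ * R * Module.finrank ℝ X + R * dualNorm H (g 0) + R * traceNorm (opSqrt (accum H δ g K))

end GenLeon

end

/-!
The regret bound holds with `C = 8`, and its last term `R ‖√S_K‖_tr` alone suffices.

Closure under `F ↦ A F A` gives `H` a functional calculus: square roots of operators in `H` are
polynomials in them, and inverses lie in `H` because `F ↦ L F L` is an injective endomorphism of
`H`. The same closure makes `P_H` commute with `F ↦ A F A` for `A ∈ H` (`opProj_conj`), and
`tr (B (P_H (z ⊗ z))) = ⟪z, B z⟫` for `B ∈ H`. No calculus of matrix functions is needed: everything
follows from `2 tr √N ≤ tr (L⁻¹ N) + tr L` (`IsSqrtPair.two_mul_trace_opSqrt_le`), from operator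
monotonicity of the square root (`le_of_mul_self_le`) and from antitonicity of the inverse.

* Let `φ_S m = tr √(P_H (m ⊗ m) + S)`, so that the dual regularizer is `R φ_S`, and let `L` be the
  root inside the trace. The variational bound with `L` fixed is a quadratic upper bound of `φ_S`
  touching it at `m`; completing squares gives the tangent `⟪L⁻¹ m, ·⟫` as a lower bound
  (`IsSqrtPair.le_potential`). Hence `∇ φ_S m = L⁻¹ m`, and feasibility is
  `P_H (L⁻¹ m ⊗ L⁻¹ m) = L⁻¹ (P_H (m ⊗ m)) L⁻¹ ≤ I`.
* For a comparator `u` in the decision set, `⟪m, -u⟫ ≤ R φ_S m` (`IsSqrtPair.neg_inner_le`). Thus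
  the regret is at most `R φ_{S_K} (m_K) + ∑ ⟪g_k, x_k⟫`, which telescopes into the amounts by
  which the potential exceeds its linearization at each step.
* Since gradients are unbounded, a step must be estimated through a preconditioner that has already
  seen `g`. With `G = P_H (g ⊗ g)` and `L'² = L² + 2 G`, the excess is at most
  `2 (tr L' - tr L) ≤ 4 tr (L'⁻¹ G) ≤ 4 tr ((S + G)^(-1/2) G) ≤ 8 (tr √(S + G) - tr √S)`
  (`IsSqrtPair.potential_increment_le`), and these bounds telescope to `8 tr √S_K`.

The limit `δ → 0` is uniform because `√T ≤ √(T + δ² I) ≤ √T + δ I`.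
-/

set_option linter.unusedSectionVars false

namespace GenLeon

variable {X : Type*} [NormedAddCommGroup X] [InnerProductSpace ℝ X] [FiniteDimensional ℝ X]

/-! ### Positive semidefinite operators -/

theorem nonneg_iff {A : X →ₗ[ℝ] X} :
    0 ≤ A ↔ A.IsSymmetric ∧ ∀ x : X, 0 ≤ ⟪x, A x⟫_ℝ := by
  rw [LinearMap.nonneg_iff_isPositive, LinearMap.isPositive_iff]
  simp only [real_inner_comm]

theorem isSymmetric_of_nonneg {A : X →ₗ[ℝ] X} (hA : 0 ≤ A) : A.IsSymmetric :=
  (nonneg_iff.1 hA).1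

theorem inner_nonneg_of_nonneg {A : X →ₗ[ℝ] X} (hA : 0 ≤ A) (x : X) : 0 ≤ ⟪x, A x⟫_ℝ :=
  (nonneg_iff.1 hA).2 x

theorem inner_le_of_le {A B : X →ₗ[ℝ] X} (h : A ≤ B) (x : X) : ⟪x, A x⟫_ℝ ≤ ⟪x, B x⟫_ℝ := by
  have := inner_nonneg_of_nonneg (sub_nonneg.2 h) x
  rw [LinearMap.sub_apply, inner_sub_right] at this
  linarith

theorem outer_apply (z x : X) : outer z x = ⟪z, x⟫_ℝ • z := by
  simp [outer]

theorem outer_nonneg (z : X) : 0 ≤ outer z := by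
  rw [LinearMap.nonneg_iff_isPositive]
  exact (ContinuousLinearMap.isPositive_toLinearMap_iff _).2
    (InnerProductSpace.isPositive_rankOne_self _)

@[simp]
theorem outer_zero : outer (0 : X) = 0 := by
  ext x; simp [outer_apply]

theorem outer_map {A : X →ₗ[ℝ] X} (hA : A.IsSymmetric) (z : X) :
    outer (A z) = A * outer z * A := by
  ext x
  simp [outer_apply, Module.End.mul_apply, hA z x]

theorem outer_smul (c : ℝ) (z : X) : outer (c • z) = c ^ 2 • outer z := by
  ext x
  simp [outer_apply, real_inner_smul_left, smul_smul]
  ring_nf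

theorem trace_mul_outer (A : X →ₗ[ℝ] X) (z : X) :
    LinearMap.trace ℝ X (A * outer z) = ⟪z, A z⟫_ℝ := by
  have h : A * outer z = (InnerProductSpace.rankOne ℝ (A z) z : X →L[ℝ] X) := by
    ext x; simp [outer_apply, Module.End.mul_apply]
  rw [h, InnerProductSpace.trace_rankOne]

theorem conj_nonneg {A B : X →ₗ[ℝ] X} (hA : A.IsSymmetric) (hB : 0 ≤ B) : 0 ≤ A * B * A := by
  refine nonneg_iff.2 ⟨fun x y => ?_, fun x => ?_⟩
  · simp only [Module.End.mul_apply]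
    rw [hA, isSymmetric_of_nonneg hB, hA]
  · simp only [Module.End.mul_apply]
    rw [← hA]
    exact inner_nonneg_of_nonneg hB _

theorem conj_mono {A B C : X →ₗ[ℝ] X} (hA : A.IsSymmetric) (h : B ≤ C) :
    A * B * A ≤ A * C * A := by
  have := conj_nonneg hA (sub_nonneg.2 h)
  rwa [mul_sub, sub_mul, sub_nonneg] at this

theorem trace_nonneg {A : X →ₗ[ℝ] X} (hA : 0 ≤ A) : 0 ≤ LinearMap.trace ℝ X A :=
  ((LinearMap.nonneg_iff_isPositive A).1 hA).trace_nonneg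

theorem trace_mono {A B : X →ₗ[ℝ] X} (h : A ≤ B) :
    LinearMap.trace ℝ X A ≤ LinearMap.trace ℝ X B := by
  have := trace_nonneg (sub_nonneg.2 h)
  rw [map_sub] at this
  linarith

/-- The square root turns a product `A B` into the congruence `√A B √A`, which has the same trace. -/
theorem trace_mul_nonneg {A B : X →ₗ[ℝ] X} (hA : 0 ≤ A) (hB : 0 ≤ B) :
    0 ≤ LinearMap.trace ℝ X (A * B) := by
  have hA' := (LinearMap.nonneg_iff_isPositive A).1 hA
  have h : LinearMap.trace ℝ X (A * B) =
      LinearMap.trace ℝ X (opSqrt A * B * opSqrt A) := by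
    rw [LinearMap.trace_mul_comm ℝ (opSqrt A * B), ← mul_assoc, opSqrt_mul_self hA']
  rw [h]
  exact trace_nonneg (conj_nonneg (opSqrt_isPositive A).isSymmetric hB)

theorem trace_mul_mono_right {A B C : X →ₗ[ℝ] X} (hA : 0 ≤ A) (h : B ≤ C) :
    LinearMap.trace ℝ X (A * B) ≤ LinearMap.trace ℝ X (A * C) := by
  have := trace_mul_nonneg hA (sub_nonneg.2 h)
  rw [mul_sub, map_sub] at this
  linarith

theorem trace_mul_mono_left {A B C : X →ₗ[ℝ] X} (hA : 0 ≤ A) (h : B ≤ C) :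
    LinearMap.trace ℝ X (B * A) ≤ LinearMap.trace ℝ X (C * A) := by
  rw [LinearMap.trace_mul_comm ℝ B, LinearMap.trace_mul_comm ℝ C]
  exact trace_mul_mono_right hA h

/-- Operator monotonicity of the square root: an eigenvector of `B - A` with a negative
eigenvalue `c` would give `c ⟪v, (A + B) v⟫ = ⟪v, (B² - A²) v⟫ ≥ 0`, hence `⟪v, (B - A) v⟫ = 0`. -/
theorem le_of_mul_self_le {A B : X →ₗ[ℝ] X} (hA : 0 ≤ A) (hB : 0 ≤ B) (h : A * A ≤ B * B) :
    A ≤ B := by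
  have sA := isSymmetric_of_nonneg hA
  have sB := isSymmetric_of_nonneg hB
  have hs : (B - A).IsSymmetric := sB.sub sA
  have hev : ∀ i, 0 ≤ hs.eigenvalues rfl i := by
    intro i
    set c := hs.eigenvalues rfl i with hc
    set v := hs.eigenvectorBasis rfl i with hv
    have hvn : ‖v‖ = 1 := (hs.eigenvectorBasis rfl).orthonormal.1 i
    have he : B v = A v + c • v := by
      have := hs.apply_eigenvectorBasis rfl i
      rw [LinearMap.sub_apply, sub_eq_iff_eq_add, add_comm] at this
      exact this
    by_contra! hneg
    have h1 := inner_le_of_le h v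
    simp only [Module.End.mul_apply] at h1
    rw [← sA, ← sB, he] at h1
    simp only [inner_add_left, inner_add_right, real_inner_smul_left, real_inner_smul_right,
      real_inner_self_eq_norm_sq, norm_smul, hvn, mul_one, Real.norm_eq_abs, sq_abs] at h1
    have h2 := inner_nonneg_of_nonneg hA v
    have h3 := inner_nonneg_of_nonneg hB v
    rw [he, inner_add_right, real_inner_smul_right, real_inner_self_eq_norm_sq, hvn] at h3
    rw [real_inner_comm v (A v)] at h1
    nlinarith [mul_pos_of_neg_of_neg hneg hneg]
  rw [← sub_nonneg, nonneg_iff]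
  refine ⟨hs, fun x => ?_⟩
  rw [← (hs.eigenvectorBasis rfl).sum_inner_mul_inner x ((B - A) x)]
  refine Finset.sum_nonneg fun i _ => ?_
  rw [← hs, hs.apply_eigenvectorBasis, RCLike.ofReal_real_eq_id, id, real_inner_smul_left,
    real_inner_comm x]
  have := hev i
  nlinarith [mul_nonneg this (mul_self_nonneg ⟪x, hs.eigenvectorBasis rfl i⟫_ℝ)]

theorem opSqrt_nonneg (A : X →ₗ[ℝ] X) : 0 ≤ opSqrt A :=
  (LinearMap.nonneg_iff_isPositive _).2 (opSqrt_isPositive A)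

theorem opSqrt_sq {A : X →ₗ[ℝ] X} (hA : 0 ≤ A) : opSqrt A * opSqrt A = A :=
  opSqrt_mul_self ((LinearMap.nonneg_iff_isPositive _).1 hA)

theorem mul_self_nonneg_of_isSymmetric {A : X →ₗ[ℝ] X} (hA : A.IsSymmetric) : 0 ≤ A * A := by
  have := conj_nonneg hA ((LinearMap.nonneg_iff_isPositive 1).2 LinearMap.isPositive_one)
  rwa [mul_one] at this

theorem opSqrt_unique {A B : X →ₗ[ℝ] X} (hB : 0 ≤ B) (h : B * B = A) : opSqrt A = B := by
  have hA : 0 ≤ A := h ▸ mul_self_nonneg_of_isSymmetric (isSymmetric_of_nonneg hB)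
  apply le_antisymm
  · exact le_of_mul_self_le (opSqrt_nonneg A) hB (by rw [opSqrt_sq hA, h])
  · exact le_of_mul_self_le hB (opSqrt_nonneg A) (by rw [opSqrt_sq hA, h])

theorem opSqrt_mono {A B : X →ₗ[ℝ] X} (hA : 0 ≤ A) (h : A ≤ B) : opSqrt A ≤ opSqrt B :=
  le_of_mul_self_le (opSqrt_nonneg A) (opSqrt_nonneg B)
    (by rwa [opSqrt_sq hA, opSqrt_sq (hA.trans h)])

theorem traceNorm_opSqrt (A : X →ₗ[ℝ] X) :
    traceNorm (opSqrt A) = LinearMap.trace ℝ X (opSqrt A) := by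
  rw [traceNorm, (opSqrt_isPositive A).adjoint_eq, opSqrt_unique (opSqrt_nonneg A) rfl]

theorem smul_one_nonneg {c : ℝ} (hc : 0 ≤ c) : 0 ≤ c • (1 : X →ₗ[ℝ] X) :=
  (LinearMap.nonneg_iff_isPositive _).2 (LinearMap.isPositive_one.smul_of_nonneg hc)

theorem isPosDef_smul_one {c : ℝ} (hc : 0 < c) : IsPosDef (c • (1 : X →ₗ[ℝ] X)) := by
  refine ⟨isSymmetric_of_nonneg (smul_one_nonneg hc.le), fun x hx => ?_⟩
  simp only [LinearMap.smul_apply, Module.End.one_apply, real_inner_smul_right]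
  have := real_inner_self_pos.2 hx
  positivity

theorem isPosDef_nonneg_add {A B : X →ₗ[ℝ] X} (hA : 0 ≤ A) (hB : IsPosDef B) :
    IsPosDef (A + B) := by
  refine ⟨(isSymmetric_of_nonneg hA).add hB.1, fun x hx => ?_⟩
  rw [LinearMap.add_apply, inner_add_right]
  linarith [inner_nonneg_of_nonneg hA x, hB.2 x hx]

theorem nonneg_of_isPosDef {A : X →ₗ[ℝ] X} (hA : IsPosDef A) : 0 ≤ A := by
  refine nonneg_iff.2 ⟨hA.1, fun x => ?_⟩
  rcases eq_or_ne x 0 with rfl | hx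
  · simp
  · exact (hA.2 x hx).le

/-- Inversion is antitone: with `D = L' - L` one has `J - J' = J' D J' + J' D J D J'`. -/
theorem inv_anti {L J L' J' : X →ₗ[ℝ] X} (hJ : 0 ≤ J) (hJ' : 0 ≤ J') (hLJ : L * J = 1)
    (hJL : J * L = 1) (hLJ' : L' * J' = 1) (hJL' : J' * L' = 1) (hL : L.IsSymmetric)
    (hL' : L'.IsSymmetric) (h : L ≤ L') : J' ≤ J := by
  have key : J - J' = J' * (L' - L) * J' + J' * ((L' - L) * J * (L' - L)) * J' := by
    have e1 : J' * (L' - L) = 1 - J' * L := by rw [mul_sub, hJL']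
    have e2 : (L' - L) * J' = 1 - L * J' := by rw [sub_mul, hLJ']
    calc J - J' = (1 - J' * L) * J' + (1 - J' * L) * J * (1 - L * J') := by
          have a1 : J' * L * J = J' := by rw [mul_assoc, hLJ, mul_one]
          have a2 : J * (L * J') = J' := by rw [← mul_assoc, hJL, one_mul]
          have a3 : (1 - J' * L) * J = J - J' := by rw [sub_mul, a1, one_mul]
          rw [a3, mul_sub, mul_one, sub_mul J J', a2, sub_mul 1 (J' * L) J']
          simp only [one_mul, mul_assoc]
          abel
      _ = _ := by rw [← e1, ← e2]; simp only [mul_assoc]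
  rw [← sub_nonneg, key]
  have sJ' := isSymmetric_of_nonneg hJ'
  exact add_nonneg (conj_nonneg sJ' (sub_nonneg.2 h))
    (conj_nonneg sJ' (conj_nonneg (hL'.sub hL) hJ))

/-! ### The projection onto an admissible space -/

variable {H : Submodule ℝ (X →ₗ[ℝ] X)}

theorem opProj_eq_of_mem_of_trace {F B : X →ₗ[ℝ] X} (hB : B ∈ H)
    (h : ∀ C ∈ H, LinearMap.trace ℝ X ((F - B) * LinearMap.adjoint C) = 0) :
    opProj H F = B := by
  have hD : opProj H F - B ∈ H := H.sub_mem (opProj_mem H F) hB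
  have h0 : LinearMap.trace ℝ X
      ((opProj H F - B) * LinearMap.adjoint (opProj H F - B)) = 0 := by
    have h1 := h _ hD
    have h2 := trace_sub_opProj H F hD
    rw [show opProj H F - B = (F - B) - (F - opProj H F) by abel, sub_mul, map_sub]
    rw [show (F - B) - (F - opProj H F) = opProj H F - B by abel, h1, h2, sub_zero]
  exact sub_eq_zero.1 (opInnerCore.definite _ h0)

theorem opProj_of_mem {B : X →ₗ[ℝ] X} (hB : B ∈ H) : opProj H B = B :=
  opProj_eq_of_mem_of_trace hB (by simp)

namespace IsAdmissible

theorem trace_opProj_mul (hH : IsAdmissible H) (A : X →ₗ[ℝ] X) {B : X →ₗ[ℝ] X} (hB : B ∈ H) :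
    LinearMap.trace ℝ X (B * opProj H A) = LinearMap.trace ℝ X (B * A) := by
  have h := trace_sub_opProj H A hB
  rw [(hH.symmetric B hB).adjoint_eq, sub_mul, map_sub, sub_eq_zero] at h
  rw [LinearMap.trace_mul_comm, ← h, LinearMap.trace_mul_comm]

theorem trace_mul_opProj_outer (hH : IsAdmissible H) (z : X) {B : X →ₗ[ℝ] X} (hB : B ∈ H) :
    LinearMap.trace ℝ X (B * opProj H (outer z)) = ⟪z, B z⟫_ℝ := by
  rw [hH.trace_opProj_mul _ hB, trace_mul_outer]

/-- The kernel `(x, y) ↦ ⟪y, P_H (x ⊗ x) y⟫` is symmetric, because `P_H` is self-adjoint. -/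
theorem inner_opProj_outer_comm (hH : IsAdmissible H) (x y : X) :
    ⟪y, opProj H (outer x) y⟫_ℝ = ⟪x, opProj H (outer y) x⟫_ℝ := by
  rw [← trace_mul_outer, ← trace_mul_outer, ← hH.trace_opProj_mul _ (opProj_mem H _),
    ← hH.trace_opProj_mul (outer x) (opProj_mem H _), LinearMap.trace_mul_comm]

/-- The congruence `F ↦ A F A` with `A ∈ H` preserves `H` and is self-adjoint, so it commutes with
the orthogonal projection. -/
theorem opProj_conj (hH : IsAdmissible H) {A : X →ₗ[ℝ] X} (hA : A ∈ H) (F : X →ₗ[ℝ] X) :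
    opProj H (A * F * A) = A * opProj H F * A := by
  refine opProj_eq_of_mem_of_trace (hH.mul_mul_mem A hA _ (opProj_mem H F)) fun C hC => ?_
  have h := trace_sub_opProj H F (hH.mul_mul_mem A hA C hC)
  rw [(hH.symmetric _ (hH.mul_mul_mem A hA C hC)).adjoint_eq] at h
  rw [(hH.symmetric C hC).adjoint_eq, ← sub_mul, ← mul_sub, ← h, mul_assoc, mul_assoc,
    LinearMap.trace_mul_comm]
  simp only [mul_assoc]

theorem opProj_nonneg (hH : IsAdmissible H) {A : X →ₗ[ℝ] X} (hA : 0 ≤ A) : 0 ≤ opProj H A := by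
  refine nonneg_iff.2 ⟨hH.symmetric _ (opProj_mem H A), fun x => ?_⟩
  rcases eq_or_ne x 0 with rfl | hx
  · simp
  -- The hypothesis concerns positive definite operators only: pass to the limit in `A + ε I`.
  have h : ∀ ε : ℝ, 0 < ε → 0 ≤ ⟪x, opProj H A x⟫_ℝ + ε * ⟪x, x⟫_ℝ := by
    intro ε hε
    have := (hH.proj_posDef _ (isPosDef_nonneg_add hA (isPosDef_smul_one hε))).2 x hx
    rw [map_add, map_smul, opProj_of_mem hH.one_mem, LinearMap.add_apply, inner_add_right,
      LinearMap.smul_apply, Module.End.one_apply, real_inner_smul_right] at this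
    exact this.le
  refine le_of_forall_pos_le_add fun ε hε => ?_
  have hx' := real_inner_self_pos.2 hx
  have := h (ε / ⟪x, x⟫_ℝ) (by positivity)
  rwa [div_mul_cancel₀ _ hx'.ne'] at this

theorem opProj_outer_nonneg (hH : IsAdmissible H) (z : X) : 0 ≤ opProj H (outer z) :=
  hH.opProj_nonneg (outer_nonneg z)

theorem pow_mem (hH : IsAdmissible H) {A : X →ₗ[ℝ] X} (hA : A ∈ H) : ∀ n : ℕ, A ^ n ∈ H
  | 0 => by simpa using hH.one_mem
  | 1 => by simpa using hA
  | n + 2 => by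
    have := hH.mul_mul_mem A hA _ (pow_mem hH hA n)
    rwa [← pow_succ', ← pow_succ] at this

theorem aeval_mem (hH : IsAdmissible H) {A : X →ₗ[ℝ] X} (hA : A ∈ H) (p : Polynomial ℝ) :
    Polynomial.aeval A p ∈ H := by
  rw [Polynomial.aeval_eq_sum_range]
  exact H.sum_mem fun i _ => H.smul_mem _ (hH.pow_mem hA i)

/-- The square root is a polynomial in the operator, by interpolation at the eigenvalues. -/
theorem opSqrt_mem (hH : IsAdmissible H) {A : X →ₗ[ℝ] X} (hA : A ∈ H) : opSqrt A ∈ H := by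
  have h := hH.symmetric A hA
  set s : Finset ℝ := Finset.univ.image (h.eigenvalues rfl)
  set p := Lagrange.interpolate s id Real.sqrt
  have hp : opSqrt A = Polynomial.aeval A p := by
    refine (h.eigenvectorBasis rfl).toBasis.ext fun j => ?_
    have hj := h.hasEigenvector_eigenvectorBasis rfl j
    rw [OrthonormalBasis.coe_toBasis, Module.End.aeval_apply_of_hasEigenvector hj]
    have hev : p.eval (h.eigenvalues rfl j) = Real.sqrt (h.eigenvalues rfl j) :=
      Lagrange.eval_interpolate_at_node (v := id) (i := h.eigenvalues rfl j) Real.sqrt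
        Function.injective_id.injOn (Finset.mem_image_of_mem _ (Finset.mem_univ j))
    rw [RCLike.ofReal_real_eq_id, id, hev]
    simp only [opSqrt, h, dite_true, LinearMap.sum_apply, LinearMap.smul_apply, outer_apply]
    rw [Finset.sum_eq_single j]
    · simp
    · intro i _ hij
      rw [orthonormal_iff_ite.1 (h.eigenvectorBasis rfl).orthonormal i j]
      simp [hij]
    · simp
  rw [hp]
  exact hH.aeval_mem hA p

end IsAdmissible

/-! ### Preconditioners -/

/-- `L` is the square root of `M` and `J` its inverse, both of them in `H`. -/
structure IsSqrtPair (H : Submodule ℝ (X →ₗ[ℝ] X)) (M L J : X →ₗ[ℝ] X) : Prop where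
  sqrt_mem : L ∈ H
  inv_mem : J ∈ H
  sqrt_nonneg : 0 ≤ L
  inv_nonneg : 0 ≤ J
  sq_eq : L * L = M
  mul_inv : L * J = 1
  inv_mul : J * L = 1

theorem IsAdmissible.exists_isSqrtPair (hH : IsAdmissible H) {M : X →ₗ[ℝ] X} (hM : M ∈ H)
    (hpos : IsPosDef M) : ∃ L J, IsSqrtPair H M L J := by
  set L := opSqrt M
  have hL : L ∈ H := hH.opSqrt_mem hM
  have hsq : L * L = M := opSqrt_sq (nonneg_of_isPosDef hpos)
  have hu : IsUnit L := by
    rw [LinearMap.isUnit_iff_ker_eq_bot, LinearMap.ker_eq_bot']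
    intro x hx
    by_contra hx0
    have := hpos.2 x hx0
    rw [← hsq, Module.End.mul_apply, hx, map_zero, inner_zero_right] at this
    exact this.false
  -- `F ↦ L F L` is an injective endomorphism of `H`; the preimage of `L` is the inverse of `L`.
  let T : H →ₗ[ℝ] H :=
    { toFun := fun F => ⟨L * F * L, hH.mul_mul_mem L hL F F.2⟩
      map_add' := fun F G => by ext; simp [mul_add, add_mul]
      map_smul' := fun c F => by ext; simp }
  have hT : Function.Injective T := by
    intro F G hFG
    have : L * (F : X →ₗ[ℝ] X) * L = L * G * L := congrArg Subtype.val hFG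
    exact Subtype.ext (hu.mul_left_cancel (hu.mul_right_cancel this))
  obtain ⟨⟨J, hJ⟩, hJL⟩ := LinearMap.injective_iff_surjective.1 hT ⟨L, hL⟩
  have hJL : L * J * L = L := congrArg Subtype.val hJL
  have h1 : L * J = 1 := hu.mul_right_cancel (by rw [hJL, one_mul])
  have h2 : J * L = 1 := hu.mul_left_cancel (by rw [← mul_assoc, hJL, mul_one])
  have h3 : J * L * J = J := by rw [h2, one_mul]
  exact ⟨L, J, hL, hJ, opSqrt_nonneg M,
    h3 ▸ conj_nonneg (hH.symmetric J hJ) (opSqrt_nonneg M), hsq, h1, h2⟩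

namespace IsSqrtPair

variable {M L J : X →ₗ[ℝ] X}

theorem opSqrt_eq (h : IsSqrtPair H M L J) : opSqrt M = L :=
  opSqrt_unique h.sqrt_nonneg h.sq_eq

theorem inv_mul_eq (h : IsSqrtPair H M L J) : J * M = L := by
  rw [← h.sq_eq, ← mul_assoc, h.inv_mul, one_mul]

theorem inv_anti {M' L' J' : X →ₗ[ℝ] X} (h : IsSqrtPair H M L J) (h' : IsSqrtPair H M' L' J')
    (hM : M ≤ M') : J' ≤ J ∧ L ≤ L' := by
  have hL : L ≤ L' :=
    le_of_mul_self_le h.sqrt_nonneg h'.sqrt_nonneg (by rwa [h.sq_eq, h'.sq_eq])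
  exact ⟨GenLeon.inv_anti h.inv_nonneg h'.inv_nonneg h.mul_inv h.inv_mul h'.mul_inv h'.inv_mul
    (isSymmetric_of_nonneg h.sqrt_nonneg) (isSymmetric_of_nonneg h'.sqrt_nonneg) hL, hL⟩

/-- The variational bound `2 tr √N ≤ tr (L⁻¹ N) + tr L`, from `(√N - L) L⁻¹ (√N - L) ≥ 0`. -/
theorem two_mul_trace_opSqrt_le (h : IsSqrtPair H M L J) {N : X →ₗ[ℝ] X} (hN : 0 ≤ N) :
    2 * LinearMap.trace ℝ X (opSqrt N) ≤
      LinearMap.trace ℝ X (J * N) + LinearMap.trace ℝ X L := by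
  have h1 := trace_nonneg (conj_nonneg ((opSqrt_isPositive N).isSymmetric.sub
    (isSymmetric_of_nonneg h.sqrt_nonneg)) h.inv_nonneg)
  have e : (opSqrt N - L) * J * (opSqrt N - L) =
      opSqrt N * (J * opSqrt N) - opSqrt N - opSqrt N + L := by
    have a1 : (opSqrt N - L) * J = opSqrt N * J - 1 := by rw [sub_mul, h.mul_inv]
    have a2 : opSqrt N * J * L = opSqrt N := by rw [mul_assoc, h.inv_mul, mul_one]
    rw [a1, mul_sub, sub_mul, sub_mul, a2, one_mul, one_mul, mul_assoc]
    abel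
  rw [e, map_add, map_sub, map_sub, LinearMap.trace_mul_comm, mul_assoc, opSqrt_sq hN] at h1
  linarith

end IsSqrtPair

/-! ### The trace potential and its gradient -/

/-- The potential `tr √(P_H (m ⊗ m) + S)`, that is, the dual regularizer with `η = 1`. -/
noncomputable def potential (H : Submodule ℝ (X →ₗ[ℝ] X)) (S : X →ₗ[ℝ] X) (m : X) : ℝ :=
  LinearMap.trace ℝ X (opSqrt (opProj H (outer m) + S))

theorem dualReg_eq (η : ℝ) (S : X →ₗ[ℝ] X) :
    dualReg H η S = fun m => η * potential H S m := by
  ext m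
  rw [dualReg, traceNorm_opSqrt, potential]

variable {S M L J : X →ₗ[ℝ] X}

theorem IsAdmissible.exists_isSqrtPair_add (hH : IsAdmissible H) (hS : S ∈ H)
    (hpos : IsPosDef S) (m : X) : ∃ L J, IsSqrtPair H (opProj H (outer m) + S) L J :=
  hH.exists_isSqrtPair (H.add_mem (opProj_mem H _) hS)
    (isPosDef_nonneg_add (hH.opProj_outer_nonneg m) hpos)

namespace IsSqrtPair

theorem trace_inv_mul (h : IsSqrtPair H M L J) :
    LinearMap.trace ℝ X (J * M) = LinearMap.trace ℝ X L := by
  rw [h.inv_mul_eq]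

/-- Evaluated at any preconditioner, the variational bound is quadratic in `m`. -/
theorem two_mul_potential_le (h : IsSqrtPair H M L J) (hH : IsAdmissible H) (hS : 0 ≤ S)
    (m : X) : 2 * potential H S m ≤
      ⟪m, J m⟫_ℝ + LinearMap.trace ℝ X (J * S) + LinearMap.trace ℝ X L := by
  have := h.two_mul_trace_opSqrt_le (add_nonneg (hH.opProj_outer_nonneg m) hS)
  rwa [mul_add, map_add, hH.trace_mul_opProj_outer m h.inv_mem] at this

theorem potential_eq {m : X} (h : IsSqrtPair H (opProj H (outer m) + S) L J) :
    potential H S m = LinearMap.trace ℝ X L := by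
  rw [potential, h.opSqrt_eq]

theorem inner_add_trace {m : X} (h : IsSqrtPair H (opProj H (outer m) + S) L J)
    (hH : IsAdmissible H) :
    ⟪m, J m⟫_ℝ + LinearMap.trace ℝ X (J * S) = LinearMap.trace ℝ X L := by
  rw [← h.trace_inv_mul, mul_add, map_add, hH.trace_mul_opProj_outer m h.inv_mem]

/-- The potential lies above its tangent at `m`. Completing squares linearizes
`⟪m', L'⁻¹ m'⟫` and `tr (L'⁻¹ S)` around `L`, and the terms in `L'` cancel against `tr L'`. -/
theorem le_potential {m : X} (h : IsSqrtPair H (opProj H (outer m) + S) L J)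
    (hH : IsAdmissible H) (hS : S ∈ H) (hpos : IsPosDef S) (m' : X) :
    ⟪m', J m⟫_ℝ + LinearMap.trace ℝ X (J * S) ≤ potential H S m' := by
  obtain ⟨L', J', h'⟩ := hH.exists_isSqrtPair_add hS hpos m'
  have sJ := hH.symmetric _ h.inv_mem
  have sJ' := hH.symmetric _ h'.inv_mem
  have sL' := hH.symmetric _ h'.sqrt_mem
  have h1 := inner_nonneg_of_nonneg h'.inv_nonneg (m' - L' (J m))
  have hJL : J' (L' (J m)) = J m := LinearMap.congr_fun h'.inv_mul (J m)
  have e1 : ⟪L' (J m), J' m'⟫_ℝ = ⟪m', J m⟫_ℝ := by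
    rw [← sJ', hJL, real_inner_comm]
  have e2 : ⟪L' (J m), J m⟫_ℝ = LinearMap.trace ℝ X (J * L' * J * opProj H (outer m)) := by
    rw [hH.trace_mul_opProj_outer m (hH.mul_mul_mem J h.inv_mem L' h'.sqrt_mem),
      Module.End.mul_apply, Module.End.mul_apply, ← sJ, real_inner_comm]
  rw [map_sub, hJL, inner_sub_left, inner_sub_right, inner_sub_right, e1, e2] at h1
  have h2 := trace_mul_nonneg (conj_nonneg (sJ'.sub sJ) h'.sqrt_nonneg)
    (nonneg_of_isPosDef hpos)
  have e3 : (J' - J) * L' * (J' - J) = J' - J - J + J * L' * J := by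
    have a1 : (J' - J) * L' = 1 - J * L' := by rw [sub_mul, h'.inv_mul]
    rw [a1, sub_mul, one_mul, mul_sub, mul_assoc J L' J', h'.mul_inv, mul_one]
    abel
  rw [e3, add_mul, sub_mul, sub_mul, map_add, map_sub, map_sub] at h2
  have e4 : LinearMap.trace ℝ X (J * L' * J * opProj H (outer m)) +
      LinearMap.trace ℝ X (J * L' * J * S) = LinearMap.trace ℝ X L' := by
    rw [← map_add, ← mul_add, mul_assoc _ J, h.inv_mul_eq, LinearMap.trace_mul_comm,
      ← mul_assoc, h.mul_inv, one_mul]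
  have e5 := h'.inner_add_trace hH
  rw [h'.potential_eq]
  linarith

theorem hasGradientAt_potential {m : X} (h : IsSqrtPair H (opProj H (outer m) + S) L J)
    (hH : IsAdmissible H) (hS : S ∈ H) (hpos : IsPosDef S) :
    HasGradientAt (potential H S) (J m) m := by
  rw [hasGradientAt_iff_isLittleO_nhds_zero]
  have sJ := hH.symmetric _ h.inv_mem
  have hO : (fun x => potential H S (m + x) - potential H S m - ⟪J m, x⟫_ℝ) =O[𝓝 0]
      fun x => ‖x‖ ^ 2 := by
    refine Asymptotics.IsBigO.of_bound (‖LinearMap.toContinuousLinearMap J‖)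
      (Eventually.of_forall fun x => ?_)
    have h1 := h.le_potential hH hS hpos (m + x)
    have h2 := h.two_mul_potential_le hH (nonneg_of_isPosDef hpos) (m + x)
    have h3 := h.inner_add_trace hH
    have h4 := h.potential_eq
    have h5 : ⟪x, J x⟫_ℝ ≤ ‖LinearMap.toContinuousLinearMap J‖ * ‖x‖ ^ 2 := by
      refine (real_inner_le_norm _ _).trans ?_
      have := (LinearMap.toContinuousLinearMap J).le_opNorm x
      rw [LinearMap.coe_toContinuousLinearMap'] at this
      nlinarith [norm_nonneg x]
    have h6 := inner_nonneg_of_nonneg h.inv_nonneg x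
    rw [inner_add_left] at h1
    rw [map_add, inner_add_left, inner_add_right, inner_add_right, ← sJ m x,
      real_inner_comm (J m) x] at h2
    rw [real_inner_comm (J m) x] at h1
    rw [norm_pow, norm_norm, Real.norm_eq_abs, abs_of_nonneg (by linarith)]
    linarith
  refine hO.trans_isLittleO ?_
  simpa using Asymptotics.isLittleO_norm_pow_id (E' := X) one_lt_two

/-! ### Feasibility -/

/-- Preconditioning a vector by the inverse root of an upper bound of its outer product lands in the
unit ball of the primal norm. -/
theorem opProj_outer_inv_le (h : IsSqrtPair H M L J) (hH : IsAdmissible H) {z : X}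
    (hz : opProj H (outer z) ≤ M) : opProj H (outer (J z)) ≤ 1 := by
  have sJ := hH.symmetric _ h.inv_mem
  rw [outer_map sJ, hH.opProj_conj h.inv_mem]
  refine (conj_mono sJ hz).trans_eq ?_
  rw [h.inv_mul_eq, h.mul_inv]

end IsSqrtPair

theorem le_smul_one_iff {A : X →ₗ[ℝ] X} (hA : A.IsSymmetric) {c : ℝ} (hc : 0 ≤ c) :
    A ≤ c • 1 ↔ ∀ y, ⟪y, A y⟫_ℝ ≤ c * ‖y‖ ^ 2 := by
  have hs : (c • (1 : X →ₗ[ℝ] X) - A).IsSymmetric :=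
    (isSymmetric_of_nonneg (smul_one_nonneg hc)).sub hA
  rw [← sub_nonneg, nonneg_iff]
  simp only [hs, true_and, LinearMap.sub_apply, LinearMap.smul_apply, Module.End.one_apply,
    inner_sub_right, real_inner_smul_right, real_inner_self_eq_norm_sq, sub_nonneg]

theorem primalNorm_le_iff (hH : IsAdmissible H) {R : ℝ} (hR : 0 ≤ R) (x : X) :
    primalNorm H x ≤ R ↔ opProj H (outer x) ≤ R ^ 2 • 1 := by
  set B := opProj H (outer x) with hB
  have hB0 : 0 ≤ B := hH.opProj_outer_nonneg x
  have key : ∀ y, ‖opSqrt B y‖ ^ 2 = ⟪y, B y⟫_ℝ := fun y => by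
    conv_rhs => rw [← opSqrt_sq hB0]
    rw [Module.End.mul_apply, ← (opSqrt_isPositive B).isSymmetric, real_inner_self_eq_norm_sq]
  rw [primalNorm, opNorm, ContinuousLinearMap.opNorm_le_iff hR,
    le_smul_one_iff (isSymmetric_of_nonneg hB0) (sq_nonneg R)]
  refine forall_congr' fun y => ?_
  rw [LinearMap.coe_toContinuousLinearMap', ← key, ← mul_pow,
    sq_le_sq₀ (norm_nonneg _) (by positivity)]

theorem isCompact_decisionSet (hH : IsAdmissible H) {R : ℝ} (hR : 0 ≤ R) :
    IsCompact (decisionSet H R) := by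
  have : ProperSpace X := FiniteDimensional.proper ℝ X
  have hset : decisionSet H R =
      ⋂ y : X, {x | ⟪x, opProj H (outer y) x⟫_ℝ ≤ R ^ 2 * ‖y‖ ^ 2} := by
    ext x
    simp only [decisionSet, Set.mem_ofPred_eq, primalNorm_le_iff hH hR, Set.mem_iInter,
      le_smul_one_iff (isSymmetric_of_nonneg (hH.opProj_outer_nonneg x)) (sq_nonneg R),
      hH.inner_opProj_outer_comm x]
  refine Metric.isCompact_of_isClosed_isBounded ?_ ?_
  · rw [hset]
    refine isClosed_iInter fun y => isClosed_le ?_ continuous_const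
    exact continuous_id.inner (LinearMap.continuous_of_finiteDimensional _)
  · -- `‖x‖² = tr (P_H (x ⊗ x)) ≤ R² dim X`
    refine isBounded_iff_forall_norm_le.2
      ⟨Real.sqrt (R ^ 2 * Module.finrank ℝ X), fun x hx => Real.le_sqrt_of_sq_le ?_⟩
    have h1 := trace_mono ((primalNorm_le_iff hH hR x).1 hx)
    have h2 := hH.trace_mul_opProj_outer x hH.one_mem
    rw [one_mul, Module.End.one_apply, real_inner_self_eq_norm_sq] at h2
    rw [h2, map_smul, LinearMap.trace_one, smul_eq_mul] at h1
    exact h1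

theorem zero_mem_decisionSet (hH : IsAdmissible H) {R : ℝ} (hR : 0 ≤ R) :
    (0 : X) ∈ decisionSet H R := by
  rw [decisionSet, Set.mem_ofPred_eq, primalNorm_le_iff hH hR, outer_zero, map_zero]
  exact smul_one_nonneg (sq_nonneg R)

/-! ### The increment of the potential and the comparator -/

namespace IsSqrtPair

/-- The increment of the potential beyond its linearization is at most `8` times that of
`tr √S`, whatever the size of the new gradient `g`. With `G = P_H (g ⊗ g)`, all error terms are
bounded by `tr (L'⁻¹ G)` for the square root `L'` of `L² + 2 G`, which already contains `g`. -/
theorem potential_increment_le {m : X} (h : IsSqrtPair H (opProj H (outer m) + S) L J)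
    (hH : IsAdmissible H) (hS : S ∈ H) (hpos : IsPosDef S) (g : X) :
    potential H (S + opProj H (outer g)) (m + g) - potential H S m - ⟪J m, g⟫_ℝ ≤
      8 * (LinearMap.trace ℝ X (opSqrt (S + opProj H (outer g))) -
        LinearMap.trace ℝ X (opSqrt S)) := by
  set G := opProj H (outer g) with hG
  set N := opProj H (outer m) with hN
  have hG0 : 0 ≤ G := hH.opProj_outer_nonneg g
  have hN0 : 0 ≤ N := hH.opProj_outer_nonneg m
  have hS0 : 0 ≤ S := nonneg_of_isPosDef hpos
  have hGm : G ∈ H := opProj_mem H _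
  have hNm : N ∈ H := opProj_mem H _
  obtain ⟨K, Q, hK⟩ := hH.exists_isSqrtPair (H.add_mem hS hGm)
    (by rw [add_comm]; exact isPosDef_nonneg_add hG0 hpos)
  obtain ⟨L', J', h'⟩ := hH.exists_isSqrtPair
    (H.add_mem (H.add_mem (H.add_mem hNm hGm) hGm) hS)
    (isPosDef_nonneg_add (add_nonneg (add_nonneg hN0 hG0) hG0) hpos)
  have hMM' : N + S ≤ N + G + G + S := by
    rw [show N + G + G + S = N + S + (G + G) by abel]
    exact le_add_of_nonneg_right (add_nonneg hG0 hG0)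
  have hGM' : G ≤ N + G + G + S := by
    rw [show N + G + G + S = G + (N + G + S) by abel]
    exact le_add_of_nonneg_right (add_nonneg (add_nonneg hN0 hG0) hS0)
  have hKM' : S + G ≤ N + G + G + S := by
    rw [show N + G + G + S = S + G + (N + G) by abel]
    exact le_add_of_nonneg_right (add_nonneg hN0 hG0)
  have sJ' := hH.symmetric _ h'.inv_mem
  have sJ := hH.symmetric _ h.inv_mem
  obtain ⟨hJ, hL⟩ := h.inv_anti h' hMM'
  have hD : 0 ≤ L' - L := sub_nonneg.2 hL
  have hDm : L' - L ∈ H := H.sub_mem h'.sqrt_mem h.sqrt_mem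
  have mulG : LinearMap.trace ℝ X (J' * G) = ⟪g, J' g⟫_ℝ := hH.trace_mul_opProj_outer g h'.inv_mem
  have mulN : LinearMap.trace ℝ X (J' * N) = ⟪m, J' m⟫_ℝ := hH.trace_mul_opProj_outer m h'.inv_mem
  have tL' := h'.trace_inv_mul
  simp only [mul_add, map_add] at tL'
  -- the new potential against `L'`
  have h1 : potential H (S + G) (m + g) ≤ LinearMap.trace ℝ X L' + ⟪m, J' g⟫_ℝ := by
    have := h'.two_mul_potential_le hH (add_nonneg hS0 hG0) (m + g)
    rw [map_add, inner_add_left, inner_add_right, inner_add_right, mul_add, map_add,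
      ← sJ' g m, real_inner_comm m (J' g)] at this
    linarith
  -- the two linear terms differ by `⟪L⁻¹ m, (L' - L) L'⁻¹ g⟫`, where `L⁻¹ m` and `L'⁻¹ g` both
  -- lie in the unit ball
  have h2 : ⟪m, J' g⟫_ℝ - ⟪J m, g⟫_ℝ ≤ LinearMap.trace ℝ X (L' - L) := by
    have hunit : ∀ z, opProj H (outer z) ≤ 1 →
        ⟪z, (L' - L) z⟫_ℝ ≤ LinearMap.trace ℝ X (L' - L) := fun z hz => by
      rw [← hH.trace_mul_opProj_outer z hDm]
      simpa using trace_mul_mono_right hD hz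
    have hv := hunit (J m) (h.opProj_outer_inv_le hH (le_add_of_nonneg_right hS0))
    have hw := hunit (J' g) (h'.opProj_outer_inv_le hH hGM')
    have hvw := inner_nonneg_of_nonneg hD (J m + J' g)
    have sD := hH.symmetric _ hDm
    have e : ⟪J m, (L' - L) (J' g)⟫_ℝ = ⟪J m, g⟫_ℝ - ⟪m, J' g⟫_ℝ := by
      have a1 : L' (J' g) = g := LinearMap.congr_fun h'.mul_inv g
      have a2 : J (L (J' g)) = J' g := LinearMap.congr_fun h.inv_mul (J' g)
      rw [LinearMap.sub_apply, inner_sub_right, a1, sJ m (L (J' g)), a2]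
    rw [map_add, inner_add_left, inner_add_right, inner_add_right, ← sD (J' g) (J m),
      real_inner_comm (J m) ((L' - L) (J' g)), e] at hvw
    linarith
  have h3 : LinearMap.trace ℝ X (L' - L) ≤ 2 * LinearMap.trace ℝ X (J' * G) := by
    have := trace_mul_mono_left (add_nonneg hN0 hS0) hJ
    rw [h.trace_inv_mul, mul_add, map_add] at this
    rw [map_sub]
    linarith
  have h4 : LinearMap.trace ℝ X (J' * G) ≤ LinearMap.trace ℝ X (Q * G) :=
    trace_mul_mono_left hG0 (hK.inv_anti h' hKM').1
  have h5 := hK.two_mul_trace_opSqrt_le hS0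
  have h6 := hK.trace_inv_mul
  rw [mul_add, map_add] at h6
  rw [h.potential_eq, hK.opSqrt_eq]
  rw [map_sub] at h2 h3
  linarith

/-- Duality between the potential and the decision set, by expanding
`⟪R L⁻¹ m + u, L (R L⁻¹ m + u)⟫ ≥ 0` with `⟪u, L u⟫ = tr (L P_H (u ⊗ u)) ≤ R² tr L`. -/
theorem neg_inner_le {m u : X} (h : IsSqrtPair H (opProj H (outer m) + S) L J)
    (hH : IsAdmissible H) (hS : 0 ≤ S) {R : ℝ} (hR : 0 < R)
    (hu : opProj H (outer u) ≤ R ^ 2 • 1) : -⟪m, u⟫_ℝ ≤ R * potential H S m := by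
  have h1 := inner_nonneg_of_nonneg h.sqrt_nonneg (R • J m + u)
  have hLJ : L (J m) = m := LinearMap.congr_fun h.mul_inv m
  have sL := hH.symmetric _ h.sqrt_mem
  have h2 : ⟪u, L u⟫_ℝ ≤ R ^ 2 * LinearMap.trace ℝ X L := by
    rw [← hH.trace_mul_opProj_outer u h.sqrt_mem]
    simpa using trace_mul_mono_right h.sqrt_nonneg hu
  have h3 := h.inner_add_trace hH
  have h4 := trace_mul_nonneg h.inv_nonneg hS
  have e : ⟪J m, L u⟫_ℝ = ⟪m, u⟫_ℝ := by rw [← sL, hLJ]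
  rw [map_add, map_smul, hLJ, inner_add_left, inner_add_right, inner_add_right,
    real_inner_smul_left, real_inner_smul_left, real_inner_smul_right, real_inner_smul_right, e,
    real_inner_comm m u, real_inner_comm m (J m)] at h1
  rw [h.potential_eq]
  nlinarith

end IsSqrtPair

/-! ### The regret of the algorithm -/

theorem leon_S_mem (hH : IsAdmissible H) (η δ : ℝ) (g : ℕ → X) :
    ∀ n, (leon H η δ g n).S ∈ H
  | 0 => H.smul_mem _ hH.one_mem
  | n + 1 => H.add_mem (leon_S_mem hH η δ g n) (opProj_mem H _)

theorem isPosDef_leon_S (hH : IsAdmissible H) (η : ℝ) {δ : ℝ} (hδ : 0 < δ) (g : ℕ → X) :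
    ∀ n, IsPosDef (leon H η δ g n).S
  | 0 => isPosDef_smul_one (by positivity)
  | n + 1 => by
    rw [leon, add_comm]
    exact isPosDef_nonneg_add (hH.opProj_outer_nonneg _) (isPosDef_leon_S hH η hδ g n)

theorem differentiable_dualReg (hH : IsAdmissible H) (η : ℝ) (hS : S ∈ H) (hpos : IsPosDef S) :
    Differentiable ℝ (dualReg H η S) := by
  rw [dualReg_eq]
  intro m
  obtain ⟨L, J, h⟩ := hH.exists_isSqrtPair_add hS hpos m
  exact (h.hasGradientAt_potential hH hS hpos).differentiableAt.const_mul η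

theorem leon_m_eq_sum (η δ : ℝ) (g : ℕ → X) (n : ℕ) :
    (leon H η δ g n).m = ∑ k ∈ Finset.range n, g k := by
  induction n with
  | zero => simp [leon]
  | succ n ih => rw [Finset.sum_range_succ, ← ih, leon]

/-- The initial point `0` fits the general formula, since the initial gradient sum is `0`. -/
theorem leon_x_eq (hH : IsAdmissible H) (R : ℝ) {δ : ℝ} (hδ : 0 < δ) (g : ℕ → X) (n : ℕ)
    (h : IsSqrtPair H (opProj H (outer (leon H R δ g n).m) + (leon H R δ g n).S) L J) :
    (leon H R δ g n).x = -(R • J (leon H R δ g n).m) := by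
  cases n with
  | zero => simp [leon]
  | succ n =>
    have hgrad := h.hasGradientAt_potential hH (leon_S_mem hH R δ g _)
      (isPosDef_leon_S hH R hδ g _)
    have hgrad' : HasGradientAt (dualReg H R (leon H R δ g (n + 1)).S)
        (R • J (leon H R δ g (n + 1)).m) (leon H R δ g (n + 1)).m := by
      rw [dualReg_eq, hasGradientAt_iff_hasFDerivAt, map_smul]
      exact hgrad.hasFDerivAt.const_mul R
    exact congrArg Neg.neg hgrad'.gradient

theorem leon_x_mem_decisionSet (hH : IsAdmissible H) {R δ : ℝ} (hR : 0 < R) (hδ : 0 < δ)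
    (g : ℕ → X) (n : ℕ) : (leon H R δ g n).x ∈ decisionSet H R := by
  have hS := leon_S_mem hH R δ g n
  have hpos := isPosDef_leon_S hH R hδ g n
  obtain ⟨L, J, h⟩ := hH.exists_isSqrtPair_add hS hpos (leon H R δ g n).m
  have h1 := h.opProj_outer_inv_le hH (le_add_of_nonneg_right (nonneg_of_isPosDef hpos))
  rw [decisionSet, Set.mem_ofPred_eq, primalNorm_le_iff hH hR.le, leon_x_eq hH R hδ g n h,
    ← neg_smul, outer_smul, map_smul, neg_sq, ← sub_nonneg, ← smul_sub]
  exact (LinearMap.nonneg_iff_isPositive _).2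
    (((LinearMap.nonneg_iff_isPositive _).1 (sub_nonneg.2 h1)).smul_of_nonneg (sq_nonneg R))

/-- The losses of the iterates plus the current potential are controlled by telescoping. -/
theorem sum_inner_add_potential_le (hH : IsAdmissible H) {R δ : ℝ} (hR : 0 < R) (hδ : 0 < δ)
    (g : ℕ → X) (n : ℕ) :
    ∑ k ∈ Finset.range n, ⟪g k, (leon H R δ g k).x⟫_ℝ +
        R * potential H (leon H R δ g n).S (leon H R δ g n).m ≤
      8 * R * LinearMap.trace ℝ X (opSqrt (leon H R δ g n).S) := by
  induction n with
  | zero =>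
    have := trace_nonneg (opSqrt_nonneg (δ ^ 2 • (1 : X →ₗ[ℝ] X)))
    simp only [Finset.range_zero, Finset.sum_empty, leon, potential, outer_zero, map_zero, zero_add]
    nlinarith
  | succ n ih =>
    have hS := leon_S_mem hH R δ g n
    have hpos := isPosDef_leon_S hH R hδ g n
    obtain ⟨L, J, h⟩ := hH.exists_isSqrtPair_add hS hpos (leon H R δ g n).m
    have h1 := mul_le_mul_of_nonneg_left (h.potential_increment_le hH hS hpos (g n)) hR.le
    rw [Finset.sum_range_succ, leon_x_eq hH R hδ g n h, inner_neg_right, real_inner_smul_right,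
      real_inner_comm]
    simp only [leon]
    linarith

theorem relLoss_le (hH : IsAdmissible H) {R δ : ℝ} (hR : 0 < R) (hδ : 0 < δ) (g : ℕ → X)
    (K : ℕ) {u : X} (hu : u ∈ decisionSet H R) :
    relLoss g (fun k => (leon H R δ g k).x) K u ≤
      8 * R * traceNorm (opSqrt (accum H δ g K)) := by
  have hpos := isPosDef_leon_S hH R hδ g (K + 1)
  obtain ⟨L, J, h⟩ := hH.exists_isSqrtPair_add (leon_S_mem hH R δ g (K + 1)) hpos
    (leon H R δ g (K + 1)).m
  have h1 := h.neg_inner_le hH (nonneg_of_isPosDef hpos) hR ((primalNorm_le_iff hH hR.le u).1 hu)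
  have h2 := sum_inner_add_potential_le hH hR hδ g (K + 1)
  rw [leon_m_eq_sum, sum_inner] at h1
  rw [leon_m_eq_sum] at h2
  rw [traceNorm_opSqrt, ← leon_S H R, relLoss]
  simp only [inner_sub_right, Finset.sum_sub_distrib]
  linarith

/-! ### The limit of the bound -/

/-- Adding `δ² I` moves `tr √T` by at most `δ dim X`, since `√(T + δ² I) ≤ √T + δ I`. -/
theorem abs_trace_opSqrt_add_smul_one_sub_le {T : X →ₗ[ℝ] X} (hT : 0 ≤ T) {δ : ℝ} (hδ : 0 ≤ δ) :
    |LinearMap.trace ℝ X (opSqrt (δ ^ 2 • 1 + T)) - LinearMap.trace ℝ X (opSqrt T)| ≤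
      δ * Module.finrank ℝ X := by
  have hd : 0 ≤ δ ^ 2 • (1 : X →ₗ[ℝ] X) := smul_one_nonneg (sq_nonneg δ)
  have h1 := trace_mono (opSqrt_mono hT (le_add_of_nonneg_left hd))
  have h2 : opSqrt (δ ^ 2 • 1 + T) ≤ opSqrt T + δ • 1 := by
    refine le_of_mul_self_le (opSqrt_nonneg _)
      (add_nonneg (opSqrt_nonneg T) (smul_one_nonneg hδ)) ?_
    rw [opSqrt_sq (add_nonneg hd hT)]
    have e : (opSqrt T + δ • 1) * (opSqrt T + δ • 1) =
        (δ ^ 2 • 1 + T) + (2 * δ) • opSqrt T := by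
      simp only [mul_add, add_mul, opSqrt_sq hT, mul_smul_comm, smul_mul_assoc, one_mul, mul_one]
      module
    rw [e]
    exact le_add_of_nonneg_right ((LinearMap.nonneg_iff_isPositive _).2
      ((opSqrt_isPositive T).smul_of_nonneg (by positivity : (0 : ℝ) ≤ 2 * δ)))
  have h3 := trace_mono h2
  rw [map_add, map_smul, LinearMap.trace_one, smul_eq_mul] at h3
  rw [abs_of_nonneg (sub_nonneg.2 h1)]
  linarith

theorem tendstoUniformly_boundExpr (hH : IsAdmissible H) {R : ℝ} (hR : 0 < R) (K : ℕ) :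
    TendstoUniformly (fun (δ : ℝ) (g : ℕ → X) => boundExpr H R δ g K)
      (fun g => R * dualNorm H (g 0) +
        R * traceNorm (opSqrt (∑ i ∈ Finset.range (K + 1), opProj H (outer (g i)))))
      (𝓝[>] 0) := by
  rw [Metric.tendstoUniformly_iff]
  intro ε hε
  set d : ℝ := (Module.finrank ℝ X : ℝ) with hd
  have hd0 : 0 ≤ d := Nat.cast_nonneg _
  have hc : 0 < 2 * R * d + 1 := by positivity
  filter_upwards [Ioo_mem_nhdsGT (div_pos hε hc)] with δ hδ g
  have hT : 0 ≤ ∑ i ∈ Finset.range (K + 1), opProj H (outer (g i)) :=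
    Finset.sum_nonneg fun i _ => hH.opProj_outer_nonneg (g i)
  have h1 := abs_le.1 (abs_trace_opSqrt_add_smul_one_sub_le hT hδ.1.le)
  have h2 := (lt_div_iff₀ hc).1 hδ.2
  have hδ0 := hδ.1
  rw [← hd] at h1
  rw [dist_comm, Real.dist_eq, boundExpr, accum, traceNorm_opSqrt, traceNorm_opSqrt, ← hd, abs_lt]
  have h3 := mul_le_mul_of_nonneg_left h1.1 hR.le
  have h4 := mul_le_mul_of_nonneg_left h1.2 hR.le
  constructor <;> nlinarith [mul_nonneg (mul_nonneg hδ0.le hR.le) hd0]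

theorem mul_traceNorm_le_boundExpr {R δ : ℝ} (hR : 0 < R) (hδ : 0 < δ) (g : ℕ → X) (K : ℕ) :
    R * traceNorm (opSqrt (accum H δ g K)) ≤ boundExpr H R δ g K := by
  have h : 0 ≤ dualNorm H (g 0) := trace_nonneg (opSqrt_nonneg _)
  rw [boundExpr]
  have : 0 ≤ δ * R * Module.finrank ℝ X := by positivity
  nlinarith

end GenLeon

open GenLeon in
theorem mainTheorem4 :
    ∃ C : ℝ, 0 < C ∧
      ∀ (X : Type*) [NormedAddCommGroup X] [InnerProductSpace ℝ X] [FiniteDimensional ℝ X]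
        (H : Submodule ℝ (X →ₗ[ℝ] X)), IsAdmissible H →
      ∀ (R η : ℝ), 0 < R → η = R → ∀ K : ℕ,
        (∀ (δ : ℝ), 0 < δ → ∀ g : ℕ → X,
          -- the gradients of the dual regularizers that the algorithm uses exist
          (∀ k ≤ K, Differentiable ℝ (dualReg H η (accum H δ g k))) ∧
          -- the output of the algorithm is feasible
          (∀ k ≤ K, (leon H η δ g k).x ∈ decisionSet H R) ∧
          -- the maximum in the definition of the regret is attained
          IsGreatest (relLoss g (fun k => (leon H η δ g k).x) K '' decisionSet H R)
            (regret H R g (fun k => (leon H η δ g k).x) K) ∧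
          regret H R g (fun k => (leon H η δ g k).x) K ≤ C * boundExpr H R δ g K) ∧
        -- as `δ → 0`, the bound tends, uniformly in the gradients, to one without the dimension
        TendstoUniformly (fun (δ : ℝ) (g : ℕ → X) => boundExpr H R δ g K)
          (fun g => R * dualNorm H (g 0) +
            R * traceNorm (opSqrt (∑ i ∈ Finset.range (K + 1), opProj H (outer (g i)))))
          (𝓝[>] 0) := by
  refine ⟨8, by norm_num, ?_⟩
  intro X _ _ _ H hH R η hR hη K
  subst hη
  refine ⟨fun δ hδ g => ?_, tendstoUniformly_boundExpr hH hR K⟩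
  have hcont : Continuous (relLoss g (fun k => (leon H η δ g k).x) K) := by
    unfold relLoss
    fun_prop
  have hmax : IsGreatest (relLoss g (fun k => (leon H η δ g k).x) K '' decisionSet H η)
      (regret H η g (fun k => (leon H η δ g k).x) K) :=
    ((isCompact_decisionSet hH hR.le).image hcont).isGreatest_sSup
      (Set.Nonempty.image _ ⟨0, zero_mem_decisionSet hH hR.le⟩)
  refine ⟨fun k _ => ?_, fun k _ => leon_x_mem_decisionSet hH hR hδ g k, hmax, ?_⟩
  · rw [← leon_S H η]
    exact differentiable_dualReg hH η (leon_S_mem hH η δ g _) (isPosDef_leon_S hH η hδ g _)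
  · obtain ⟨u, hu, hval⟩ := hmax.1
    rw [← hval]
    have h1 := relLoss_le hH hR hδ g K hu
    have h2 := mul_traceNorm_le_boundExpr (H := H) hR hδ g K
    linarith
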